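/- Let $K\subseteq\mathbb R$ be compact and let $C^\infty(K)=\{F|_K: F\in C^\infty(\mathbb R)\}$ (real-valued functions) carry the Fréchet space topology given by the norms $$|||f|||_n=\inf\{\|F\|_n: F\in C^\infty(\mathbb R),\ F|_K=f\},\qquad \|F\|_n=\sup\{|F^{(j)}(x)|: x\in\mathbb R,\ 0\le j\le n\}.$$ A locally convex space $X$ is said to have a dominating norm if, for some increasing sequence of seminorms $\|\cdot\|_0\le\|\cdot\|_1\le\cdots$ defining its topology, there is $n$ such that for all $m\ge n$ there are $k\ge m$ and $c>0$ with $\|x\|_m^2\le c\,\|x\|_k\|x\|_n$ for all $x\in X$. **Theorem 4.1.** If $C^\infty(K)$ has a dominating norm, then there exist positive integers $n$ and $s$ such that for all $\varepsilon\in(0,1/2)$ and all $z\in K$: if $(z-\varepsilon^s,z+\varepsilon^s)$ contains at least $n+2$ points of $K$, then $$K\cap(z-\varepsilon,z+\varepsilon)\setminus(z-\varepsilon^s,z+\varepsilon^s)\neq\emptyset.$$ -/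

import Mathlib

open Set TopologicalSpace
open scoped ENNReal ContDiff

/-- `‖F‖_n = sup {|F^(j)(x)| : x ∈ ℝ, j ≤ n}`, with values in `[0, ∞]`. -/
noncomputable def smoothNorm (n : ℕ) (F : ℝ → ℝ) : ℝ≥0∞ :=
  ⨆ (j : ℕ) (_ : j ≤ n) (x : ℝ), ‖iteratedDeriv j F x‖ₑ

/-- `F ∈ C^∞(ℝ)` and `F|_K = f`. -/
def IsSmoothExtension (K : Compacts ℝ) (f : K → ℝ) (F : ℝ → ℝ) : Prop :=
  ContDiff ℝ ∞ F ∧ ∀ x : K, F x = f x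

/-- The set `{F|_K : F ∈ C^∞(ℝ)}` as a linear subspace of the functions on `K`. -/
def smoothRestrictionSubmodule (K : Compacts ℝ) : Submodule ℝ (K → ℝ) where
  carrier := {f | ∃ F : ℝ → ℝ, IsSmoothExtension K f F}
  zero_mem' := ⟨fun _ => 0, contDiff_const, fun _ => rfl⟩
  add_mem' := by
    rintro f g ⟨F, hF, hf⟩ ⟨G, hG, hg⟩
    exact ⟨F + G, hF.add hG, fun x => by simp [hf, hg]⟩
  smul_mem' := by
    rintro c f ⟨F, hF, hf⟩
    exact ⟨c • F, contDiff_const.smul hF, fun x => by simp [hf]⟩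

/-- The space `C^∞(K)` of smooth restrictions. It is a type synonym, so that it carries its own
topology (below) and not the topology of pointwise convergence. -/
def SmoothRestrictions (K : Compacts ℝ) : Type := smoothRestrictionSubmodule K

namespace SmoothRestrictions

variable {K : Compacts ℝ}

noncomputable instance : AddCommGroup (SmoothRestrictions K) :=
  inferInstanceAs (AddCommGroup (smoothRestrictionSubmodule K))

noncomputable instance : Module ℝ (SmoothRestrictions K) :=
  inferInstanceAs (Module ℝ (smoothRestrictionSubmodule K))

/-- An element of `C^∞(K)` as a function on `K`. -/
def toFun (f : SmoothRestrictions K) : K → ℝ := f.1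

theorem toFun_add (f g : SmoothRestrictions K) : (f + g).toFun = f.toFun + g.toFun := rfl

theorem toFun_smul (c : ℝ) (f : SmoothRestrictions K) : (c • f).toFun = c • f.toFun := rfl

/-- `inf {‖F‖_n : F ∈ C^∞(ℝ), F|_K = f}`, with values in `[0, ∞]`. -/
noncomputable def quotientENorm (n : ℕ) (f : SmoothRestrictions K) : ℝ≥0∞ :=
  ⨅ (F : ℝ → ℝ) (_ : IsSmoothExtension K f.toFun F), smoothNorm n F

theorem quotientENorm_ne_top (n : ℕ) (f : SmoothRestrictions K) : quotientENorm n f ≠ ⊤ := by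
  obtain ⟨F, hF, hf⟩ := f.2
  obtain ⟨R, hR⟩ := K.isCompact.isBounded.subset_closedBall (0 : ℝ)
  let b : ContDiffBump (0 : ℝ) := ⟨|R| + 1, |R| + 2, by positivity, by linarith⟩
  have hG : ContDiff ℝ ∞ (fun x => b x * F x) := b.contDiff.mul hF
  have hs : HasCompactSupport (fun x => b x * F x) := b.hasCompactSupport.mul_right
  have hext : IsSmoothExtension K f.toFun (fun x => b x * F x) := by
    refine ⟨hG, fun x => ?_⟩
    have hx : (x : ℝ) ∈ Metric.closedBall (0 : ℝ) b.rIn :=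
      Metric.closedBall_subset_closedBall (by
        show R ≤ |R| + 1
        linarith [le_abs_self R]) (hR x.2)
    show b x * F x = f.toFun x
    rw [b.one_of_mem_closedBall hx, one_mul]
    exact hf x
  have hb : ∀ j : ℕ, ∃ C : ℝ, ∀ x, ‖iteratedDeriv j (fun x => b x * F x) x‖ ≤ C := by
    intro j
    have hc : Continuous (iteratedDeriv j (fun x => b x * F x)) :=
      hG.continuous_iteratedDeriv j (by exact_mod_cast le_top)
    obtain ⟨C, hC⟩ := (hs.iteratedFDeriv (𝕜 := ℝ) j).exists_bound_of_continuous
      (hG.continuous_iteratedFDeriv (m := j) (by exact_mod_cast le_top))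
    exact ⟨C, fun x => by rw [← norm_iteratedFDeriv_eq_norm_iteratedDeriv]; exact hC x⟩
  choose C hC using hb
  have hle : smoothNorm n (fun x => b x * F x) ≤
      ENNReal.ofReal (∑ j ∈ Finset.range (n + 1), |C j|) := by
    refine iSup_le fun j => iSup_le fun hj => iSup_le fun x => ?_
    rw [← ofReal_norm]
    refine ENNReal.ofReal_le_ofReal (((hC j x).trans (le_abs_self _)).trans ?_)
    exact Finset.single_le_sum (f := fun j => |C j|) (fun _ _ => abs_nonneg _)
      (Finset.mem_range.2 (Nat.lt_succ_of_le hj))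
  exact ne_top_of_le_ne_top ENNReal.ofReal_ne_top 
    ((iInf₂_le (f := fun F (_ : IsSmoothExtension K f.toFun F) => smoothNorm n F) _ hext).trans hle)

theorem quotientENorm_add_le (n : ℕ) (f g : SmoothRestrictions K) :
    quotientENorm n (f + g) ≤ quotientENorm n f + quotientENorm n g := by
  simp only [quotientENorm, ENNReal.iInf_add, ENNReal.add_iInf]
  refine le_iInf fun G => le_iInf fun hG => le_iInf fun F => le_iInf fun hF => ?_
  have h : IsSmoothExtension K (f + g).toFun (F + G) :=
    ⟨hF.1.add hG.1, fun x => by simp [toFun_add, hF.2, hG.2]⟩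
  refine (iInf₂_le (f := fun F (_ : IsSmoothExtension K (f + g).toFun F) => smoothNorm n F)
    _ h).trans (iSup_le fun j => iSup_le fun hj => iSup_le fun x => ?_)
  rw [iteratedDeriv_add (hF.1.contDiffAt.of_le (by exact_mod_cast le_top))
    (hG.1.contDiffAt.of_le (by exact_mod_cast le_top))]
  exact (enorm_add_le _ _).trans (add_le_add
    (le_iSup_of_le j (le_iSup_of_le hj (le_iSup (fun x => ‖iteratedDeriv j F x‖ₑ) x)))
    (le_iSup_of_le j (le_iSup_of_le hj (le_iSup (fun x => ‖iteratedDeriv j G x‖ₑ) x))))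

theorem quotientENorm_smul_le (n : ℕ) (c : ℝ) (f : SmoothRestrictions K) :
    quotientENorm n (c • f) ≤ ‖c‖ₑ * quotientENorm n f := by
  have key : ∀ F, IsSmoothExtension K f.toFun F →
      quotientENorm n (c • f) ≤ ‖c‖ₑ * smoothNorm n F := by
    intro F hF
    have h : IsSmoothExtension K (c • f).toFun (c • F) :=
      ⟨contDiff_const.smul hF.1, fun x => by simp [toFun_smul, hF.2]⟩
    refine (iInf₂_le (f := fun F (_ : IsSmoothExtension K (c • f).toFun F) => smoothNorm n F)
      _ h).trans (iSup_le fun j => iSup_le fun hj => iSup_le fun x => ?_)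
    rw [iteratedDeriv_const_smul_field, enorm_smul]
    gcongr
    exact le_iSup_of_le j (le_iSup_of_le hj (le_iSup (fun x => ‖iteratedDeriv j F x‖ₑ) x))
  have hlim : ∀ δ : ℝ≥0∞, quotientENorm n f < δ → quotientENorm n (c • f) ≤ ‖c‖ₑ * δ := by
    intro δ hδ
    simp only [quotientENorm, iInf_lt_iff] at hδ
    obtain ⟨F, hF, hlt⟩ := hδ
    exact (key F hF).trans (by gcongr)
  by_cases hc : c = 0
  · have h0 : ∀ δ : ℝ≥0∞, ‖c‖ₑ * δ = 0 := fun δ => by simp [hc]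
    rw [h0]
    exact (hlim ⊤ (quotientENorm_ne_top n f).lt_top).trans (h0 ⊤).le
  · have hc' : ‖c‖ₑ ≠ 0 := by simpa using hc
    simp only [quotientENorm, ENNReal.mul_iInf_of_ne hc' enorm_ne_top]
    exact le_iInf fun F => le_iInf fun hF => key F hF

/-- The norm `|||f|||_n = inf {‖F‖_n : F ∈ C^∞(ℝ), F|_K = f}` on `C^∞(K)`. -/
noncomputable def quotientNorm (K : Compacts ℝ) (n : ℕ) : Seminorm ℝ (SmoothRestrictions K) :=
  Seminorm.ofSMulLE (fun f => (quotientENorm n f).toReal)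
    (by
      have h := quotientENorm_smul_le n 0 (0 : SmoothRestrictions K)
      simp only [enorm_zero, zero_mul, zero_smul, nonpos_iff_eq_zero] at h
      simp [h])
    (fun f g => by
      rw [← ENNReal.toReal_add (quotientENorm_ne_top n f) (quotientENorm_ne_top n g)]
      exact ENNReal.toReal_mono (ENNReal.add_ne_top.2
        ⟨quotientENorm_ne_top n f, quotientENorm_ne_top n g⟩) (quotientENorm_add_le n f g))
    (fun c f => by
      rw [← toReal_enorm c, ← ENNReal.toReal_mul]
      exact ENNReal.toReal_mono (ENNReal.mul_ne_top enorm_ne_top (quotientENorm_ne_top n f))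
        (quotientENorm_smul_le n c f))

/-- The Fréchet topology of `C^∞(K)`: the one defined by the norms `|||·|||_n`. -/
noncomputable instance : TopologicalSpace (SmoothRestrictions K) :=
  SeminormFamily.moduleFilterBasis (𝕜 := ℝ) (quotientNorm K) |>.topology

theorem withSeminorms_quotientNorm (K : Compacts ℝ) :
    WithSeminorms (𝕜 := ℝ) (quotientNorm K) := ⟨rfl⟩

theorem monotone_quotientNorm (K : Compacts ℝ) : Monotone (quotientNorm K) := by
  intro m n hmn f
  refine ENNReal.toReal_mono (quotientENorm_ne_top n f) ?_
  exact iInf_mono fun F => iInf_mono fun _ => biSup_mono fun j hj => le_trans hj hmn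

end SmoothRestrictions

/-- `p 0 ≤ p 1 ≤ …` is an increasing sequence of seminorms defining the topology of `E`. -/
def IsFundamentalSequence {E : Type*} [AddCommGroup E] [Module ℝ E] [TopologicalSpace E]
    (p : ℕ → Seminorm ℝ E) : Prop :=
  Monotone p ∧ WithSeminorms (𝕜 := ℝ) (E := E) p

/-- The `n`-th seminorm of the sequence `p` is dominating:
for all `m ≥ n` there are `k ≥ m` and `c > 0` such that `‖x‖_m ^ 2 ≤ c ‖x‖_k ‖x‖_n` for all `x`. -/
def IsDominating {E : Type*} [AddCommGroup E] [Module ℝ E]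
    (p : ℕ → Seminorm ℝ E) (n : ℕ) : Prop :=
  ∀ m ≥ n, ∃ k ≥ m, ∃ c > (0 : ℝ), ∀ x : E, p m x ^ 2 ≤ c * p k x * p n x

/-- `E` has a dominating norm, i.e. satisfies (DN): some member of a fundamental sequence of
seminorms is dominating. (The choice of the fundamental sequence is immaterial.) -/
def HasDominatingNorm (E : Type*) [AddCommGroup E] [Module ℝ E] [TopologicalSpace E] : Prop :=
  ∃ p : ℕ → Seminorm ℝ E, IsFundamentalSequence p ∧ ∃ n : ℕ, IsDominating p n

/-! Suppose `K` meets `(z - ε, z + ε)` only within `δ = ε ^ s` of `z`. Let `f` be `(x - z) ^ (n +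
1)` on `K` near `z` and `0` on the rest of `K`. Cutting the power off at any scale `r` in `[2δ, ε]`
gives an extension of the same `f`. Scale `2δ` yields `|||f|||_n ≤ 2Aδ`, scale `ε` yields `|||f|||_k
≤ B ε⁻ᵏ` (`smoothNorm_rescale_le`). With `n + 2` points of `K` near `z`, Rolle gives every extension
a point where its derivative of order `n + 1` is `(n + 1)!`, so `|||f|||_{n+1} ≥ 1`
(`one_le_quotientNorm_of_eq_sub_pow`). The dominating inequality with `m = n + 1` then gives `1 ≤
2cAB δ ε⁻ᵏ`, which is false for large `s`. -/

/-- Iterated Rolle: a smooth function with `n + 1` zeros has an `n`-th derivative with a zero. -/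
theorem exists_iteratedDeriv_eq_zero_of_strictMono (n : ℕ) (H : ℝ → ℝ) (hH : ContDiff ℝ ∞ H)
    (x : Fin (n + 1) → ℝ) (hx : StrictMono x) (h0 : ∀ i, H (x i) = 0) :
    ∃ ξ, iteratedDeriv n H ξ = 0 := by
  induction n generalizing H with
  | zero => exact ⟨x 0, by simpa using h0 0⟩
  | succ n ih =>
    have hstep : ∀ i : Fin (n + 1), ∃ y ∈ Ioo (x i.castSucc) (x i.succ), deriv H y = 0 := fun i =>
      exists_deriv_eq_zero (hx i.castSucc_lt_succ) hH.continuous.continuousOn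
        ((h0 _).trans (h0 _).symm)
    choose y hy hy0 using hstep
    have hmono : StrictMono y := by
      refine Fin.strictMono_iff_lt_succ.2 fun i => ?_
      have h1 := (hy i.castSucc).2
      have h2 := (hy i.succ).1
      rw [Fin.succ_castSucc] at h1
      exact h1.trans h2
    rw [iteratedDeriv_succ']
    exact ih (deriv H) ((contDiff_infty_iff_deriv.1 hH).2) y hmono hy0

theorem iteratedDeriv_sub_pow_self (n : ℕ) (z x : ℝ) :
    iteratedDeriv n (fun y => (y - z) ^ n) x = n.factorial := by
  have h := congrFun (iteratedDeriv_comp_sub_const (𝕜 := ℝ) n (fun y : ℝ => y ^ n) z) x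
  rw [h, iteratedDeriv_pow]
  simp [Nat.descFactorial_self]

/-- Rolle is applied to `F - (y - z) ^ n`, which vanishes on `S`. -/
theorem exists_iteratedDeriv_eq_factorial (n : ℕ) (z : ℝ) (F : ℝ → ℝ) (hF : ContDiff ℝ ∞ F)
    (S : Set ℝ) (hS : ((n + 1 : ℕ) : ℕ∞) ≤ S.encard) (hFS : ∀ x ∈ S, F x = (x - z) ^ n) :
    ∃ ξ, iteratedDeriv n F ξ = n.factorial := by
  obtain ⟨T, hTS, hT⟩ := Set.exists_subset_encard_eq hS
  have hTf : T.Finite := Set.finite_of_encard_eq_coe hT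
  have hcard : hTf.toFinset.card = n + 1 := by
    rw [hTf.encard_eq_coe_toFinset_card] at hT
    exact_mod_cast hT
  have hpow : ContDiff ℝ ∞ fun y : ℝ => (y - z) ^ n := by fun_prop
  obtain ⟨ξ, hξ⟩ := exists_iteratedDeriv_eq_zero_of_strictMono n (F - fun y => (y - z) ^ n)
    (hF.sub hpow) (hTf.toFinset.orderEmbOfFin hcard) (OrderEmbedding.strictMono _) fun i => by
      have := hTS (hTf.mem_toFinset.1 (hTf.toFinset.orderEmbOfFin_mem hcard i))
      simp [hFS _ this]
  refine ⟨ξ, ?_⟩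
  rw [iteratedDeriv_sub (hF.contDiffAt.of_le (by exact_mod_cast le_top))
    (hpow.contDiffAt.of_le (by exact_mod_cast le_top)), iteratedDeriv_sub_pow_self] at hξ
  linarith

/-- A smooth function with compact support has bounded derivatives up to any order. -/
theorem exists_bound_iteratedDeriv_of_hasCompactSupport (ψ : ℝ → ℝ) (hψ : ContDiff ℝ ∞ ψ)
    (hs : HasCompactSupport ψ) (k : ℕ) :
    ∃ C > 0, ∀ j ≤ k, ∀ x, |iteratedDeriv j ψ x| ≤ C := by
  have hb : ∀ j : ℕ, ∃ C : ℝ, ∀ x, |iteratedDeriv j ψ x| ≤ C := by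
    intro j
    obtain ⟨C, hC⟩ := (hs.iteratedFDeriv (𝕜 := ℝ) j).exists_bound_of_continuous
      (hψ.continuous_iteratedFDeriv (m := j) (by exact_mod_cast le_top))
    exact ⟨C, fun x => by
      rw [← Real.norm_eq_abs, ← norm_iteratedFDeriv_eq_norm_iteratedDeriv]; exact hC x⟩
  choose C hC using hb
  refine ⟨∑ j ∈ Finset.range (k + 1), |C j| + 1, by positivity, fun j hj x => ?_⟩
  have := Finset.single_le_sum (f := fun j => |C j|) (fun _ _ => abs_nonneg _)
    (Finset.mem_range.2 (Nat.lt_succ_of_le hj))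
  linarith [hC j x, le_abs_self (C j)]

theorem iteratedDeriv_rescale (ψ : ℝ → ℝ) (hψ : ContDiff ℝ ∞ ψ) (a r z x : ℝ) (j : ℕ) :
    iteratedDeriv j (fun y => a * ψ ((y - z) / r)) x
      = a * r⁻¹ ^ j * iteratedDeriv j ψ ((x - z) / r) := by
  have h := congrFun (iteratedDeriv_comp_sub_const (𝕜 := ℝ) j (fun y : ℝ => ψ (r⁻¹ * y)) z) x
  have h2 := congrFun (iteratedDeriv_comp_const_mul (n := j)
    (hψ.of_le (by exact_mod_cast le_top)) r⁻¹) (x - z)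
  rw [iteratedDeriv_const_mul_field]
  simp only [div_eq_inv_mul]
  rw [h, h2, mul_assoc]

/-- The norms of the rescaling `r ^ N * ψ ((x - z) / r)` of a profile `ψ` at scale `r ≤ 1`. -/
theorem smoothNorm_rescale_le (ψ : ℝ → ℝ) (hψ : ContDiff ℝ ∞ ψ) (k N : ℕ) (C : ℝ)
    (hC : ∀ j ≤ k, ∀ x, |iteratedDeriv j ψ x| ≤ C) (z r : ℝ) (hr : 0 < r) (hr1 : r ≤ 1) :
    smoothNorm k (fun y => r ^ N * ψ ((y - z) / r)) ≤ ENNReal.ofReal (r ^ N * r⁻¹ ^ k * C) := by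
  refine iSup_le fun j => iSup_le fun hj => iSup_le fun x => ?_
  rw [← ofReal_norm]
  refine ENNReal.ofReal_le_ofReal ?_
  rw [iteratedDeriv_rescale ψ hψ, norm_mul, Real.norm_eq_abs, Real.norm_eq_abs,
    abs_of_nonneg (by positivity)]
  -- Since `r ≤ 1`, the top order `k` has the worst factor `r⁻¹ ^ j`.
  have h1 : 1 ≤ r⁻¹ := (one_le_inv₀ hr).2 hr1
  gcongr
  exact hC j hj _

/-- Continuity bounds `p i` by a finite supremum of the `q j`; monotonicity absorbs it into a single
`q M`, with `C` independent of `M`. -/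
theorem WithSeminorms.exists_le_mul {E : Type*} [AddCommGroup E] [Module ℝ E] [TopologicalSpace E]
    {p q : ℕ → Seminorm ℝ E} (hp : WithSeminorms (𝕜 := ℝ) p) (hq : WithSeminorms (𝕜 := ℝ) q)
    (hmono : Monotone q) (i : ℕ) :
    ∃ N, ∃ C > (0 : ℝ), ∀ M ≥ N, ∀ x, p i x ≤ C * q M x := by
  obtain ⟨s, C, hC, hle⟩ := Seminorm.bound_of_continuous hq (p i) (hp.continuous_seminorm i)
  refine ⟨s.sup id, C, by positivity, fun M hM x => (hle x).trans ?_⟩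
  have h : s.sup q ≤ q M := Finset.sup_le fun j hj =>
    hmono ((Finset.le_sup (f := id) hj).trans hM)
  exact mul_le_mul_of_nonneg_left (h x) C.2

/-- A dominating norm of some fundamental sequence yields one in any other fundamental sequence. -/
theorem HasDominatingNorm.exists_forall_isDominating {E : Type*} [AddCommGroup E] [Module ℝ E]
    [TopologicalSpace E] (hE : HasDominatingNorm E) {q : ℕ → Seminorm ℝ E}
    (hq : IsFundamentalSequence q) : ∃ N, ∀ n ≥ N, IsDominating q n := by
  obtain ⟨p, hp, n, hn⟩ := hE
  obtain ⟨N, A, hA, hN⟩ := hp.2.exists_le_mul hq.2 hq.1 n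
  refine ⟨N, fun n' hn' m _ => ?_⟩
  obtain ⟨l, B, hB, hl⟩ := hq.2.exists_le_mul hp.2 hp.1 m
  -- The maximum with `n` is needed because domination is only available from index `n` on.
  obtain ⟨k, -, c, hc, hk⟩ := hn (max l n) (le_max_right _ _)
  obtain ⟨k', D, hD, hk'⟩ := hp.2.exists_le_mul hq.2 hq.1 k
  refine ⟨max k' m, le_max_right _ _, B ^ 2 * c * D * A, by positivity, fun x => ?_⟩
  have h0 := apply_nonneg (p n) x
  calc q m x ^ 2 ≤ (B * p (max l n) x) ^ 2 := by
        gcongr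
        exact hl _ (le_max_left _ _) x
    _ = B ^ 2 * p (max l n) x ^ 2 := by ring
    _ ≤ B ^ 2 * (c * p k x * p n x) := by gcongr; exact hk x
    _ ≤ B ^ 2 * (c * (D * q (max k' m) x) * (A * q n' x)) := by
        gcongr
        · exact hk' _ (le_max_left _ _) x
        · exact hN _ hn' x
    _ = B ^ 2 * c * D * A * q (max k' m) x * q n' x := by ring

namespace SmoothRestrictions

variable {K : Compacts ℝ}

theorem quotientNorm_le_of_isSmoothExtension {n : ℕ} {f : SmoothRestrictions K} {F : ℝ → ℝ}
    (hF : IsSmoothExtension K f.toFun F) {C : ℝ} (hC : 0 ≤ C)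
    (h : smoothNorm n F ≤ ENNReal.ofReal C) : quotientNorm K n f ≤ C :=
  ENNReal.toReal_le_of_le_ofReal hC ((iInf₂_le (f := fun F (_ : IsSmoothExtension K f.toFun F) =>
    smoothNorm n F) F hF).trans h)

/-- The Rolle bound holds for every extension, hence survives the infimum. -/
theorem one_le_quotientNorm_of_eq_sub_pow {n : ℕ} {f : SmoothRestrictions K} {z : ℝ} {S : Set ℝ}
    (hS : ((n + 1 : ℕ) : ℕ∞) ≤ S.encard) (hSK : S ⊆ K)
    (hf : ∀ x : K, (x : ℝ) ∈ S → f.toFun x = ((x : ℝ) - z) ^ n) : 1 ≤ quotientNorm K n f := by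
  have h : ENNReal.ofReal 1 ≤ quotientENorm n f := by
    refine le_iInf fun F => le_iInf fun hF => ?_
    obtain ⟨ξ, hξ⟩ := exists_iteratedDeriv_eq_factorial n z F hF.1 S hS fun x hx =>
      (hF.2 ⟨x, hSK hx⟩).trans (hf ⟨x, hSK hx⟩ hx)
    refine le_trans ?_ (le_iSup_of_le n (le_iSup_of_le le_rfl
      (le_iSup (fun x => ‖iteratedDeriv n F x‖ₑ) ξ)))
    rw [← ofReal_norm, hξ]
    refine ENNReal.ofReal_le_ofReal ?_
    rw [Real.norm_of_nonneg (by positivity)]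
    exact_mod_cast n.factorial_pos
  exact (ENNReal.ofReal_le_iff_le_toReal (quotientENorm_ne_top n f)).1 h

end SmoothRestrictions

open SmoothRestrictions in
theorem theorem4p1 (K : Compacts ℝ) (hK : HasDominatingNorm (SmoothRestrictions K)) :
    ∃ n s : ℕ, 1 ≤ n ∧ 1 ≤ s ∧ ∀ ε ∈ Ioo (0 : ℝ) (1 / 2), ∀ z ∈ K,
      ((n + 2 : ℕ) : ℕ∞) ≤ ((K : Set ℝ) ∩ Ioo (z - ε ^ s) (z + ε ^ s)).encard →
        (((K : Set ℝ) ∩ Ioo (z - ε) (z + ε)) \ Ioo (z - ε ^ s) (z + ε ^ s)).Nonempty := by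
  obtain ⟨N, hN⟩ := hK.exists_forall_isDominating
    ⟨monotone_quotientNorm K, withSeminorms_quotientNorm K⟩
  obtain ⟨n, hn1, hnN⟩ : ∃ n, 1 ≤ n ∧ N ≤ n := ⟨N + 1, by omega, by omega⟩
  obtain ⟨k, -, c, hc, hdom⟩ := hN n hnN (n + 1) n.le_succ
  let χ : ContDiffBump (0 : ℝ) := ⟨1 / 2, 1, by norm_num, by norm_num⟩
  have hχ_one : ∀ y : ℝ, |y| ≤ 1 / 2 → χ y = 1 := fun y hy =>
    χ.one_of_mem_closedBall (by simpa [χ] using hy)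
  have hχ_zero : ∀ y : ℝ, 1 ≤ |y| → χ y = 0 := fun y hy =>
    χ.zero_of_le_dist (by simpa [χ, Real.dist_eq] using hy)
  let ψ : ℝ → ℝ := fun y => χ y * y ^ (n + 1)
  have hψ : ContDiff ℝ ∞ ψ := χ.contDiff.mul (contDiff_id.pow _)
  have hψ_supp : HasCompactSupport ψ := χ.hasCompactSupport.mul_right
  obtain ⟨A, hA, hψA⟩ := exists_bound_iteratedDeriv_of_hasCompactSupport ψ hψ hψ_supp n
  obtain ⟨B, hB, hψB⟩ := exists_bound_iteratedDeriv_of_hasCompactSupport ψ hψ hψ_supp k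
  -- As `ε < 1/2`, the factor `ε ^ a` beats the constant `2cAB` uniformly in `ε`.
  obtain ⟨a, ha⟩ := exists_pow_lt_of_lt_one (show 0 < (c * B * (2 * A))⁻¹ by positivity)
    (show (1 / 2 : ℝ) < 1 by norm_num)
  -- In `s`, `k` cancels `ε⁻¹ ^ k`, `a` absorbs the constants, and `2` ensures `2δ ≤ ε`.
  refine ⟨n, k + a + 2, hn1, by omega, fun ε ⟨hε0, hε⟩ z hz hcard => ?_⟩
  by_contra hempty
  rw [not_nonempty_iff_eq_empty] at hempty
  set δ := ε ^ (k + a + 2) with hδ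
  have hδ0 : 0 < δ := by positivity
  have hδε : 2 * δ ≤ ε := by
    have : δ ≤ ε ^ 2 := pow_le_pow_of_le_one hε0.le (by linarith) (by omega)
    nlinarith
  have hgap : ∀ x ∈ K, |x - z| < δ ∨ ε ≤ |x - z| := by
    intro x hx
    by_contra! h
    have hxε := abs_lt.1 h.2
    have : x ∈ ((K : Set ℝ) ∩ Ioo (z - ε) (z + ε)) \ Ioo (z - δ) (z + δ) :=
      ⟨⟨hx, by linarith [hxε.1], by linarith [hxε.2]⟩, fun hxδ =>
        h.1.not_gt (abs_lt.2 ⟨by linarith [hxδ.1], by linarith [hxδ.2]⟩)⟩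
    rw [hempty] at this
    exact this
  let G : ℝ → ℝ → ℝ := fun r y => r ^ (n + 1) * ψ ((y - z) / r)
  have hG : ∀ r, ContDiff ℝ ∞ (G r) := fun r => by
    have : ContDiff ℝ ∞ fun y : ℝ => (y - z) / r := (contDiff_id.sub contDiff_const).div_const r
    exact contDiff_const.mul (hψ.comp this)
  have hG_pow : ∀ r, 2 * δ ≤ r → ∀ x, |x - z| < δ → G r x = (x - z) ^ (n + 1) := by
    intro r hr x hx
    have hr0 : 0 < r := by linarith
    have : χ ((x - z) / r) = 1 := hχ_one _ (by
      rw [abs_div, abs_of_pos hr0, div_le_iff₀ hr0]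
      linarith)
    simp only [G, ψ, this, one_mul, div_pow]
    field_simp
  have hG_zero : ∀ r, 0 < r → r ≤ ε → ∀ x, ε ≤ |x - z| → G r x = 0 := by
    intro r hr0 hr x hx
    have : χ ((x - z) / r) = 0 := hχ_zero _ (by
      rw [abs_div, abs_of_pos hr0, le_div_iff₀ hr0]
      linarith)
    simp [G, ψ, this]
  let f : SmoothRestrictions K := ⟨fun x => G ε x, G ε, hG ε, fun _ => rfl⟩
  have hext : IsSmoothExtension K f.toFun (G ε) := ⟨hG ε, fun _ => rfl⟩
  -- The two cutoffs can differ only where `δ ≤ |x - z| < ε`, a region without points of `K`.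
  have hext' : IsSmoothExtension K f.toFun (G (2 * δ)) := by
    refine ⟨hG _, fun x => ?_⟩
    change G (2 * δ) x = G ε x
    rcases hgap x x.2 with h | h
    · rw [hG_pow _ le_rfl _ h, hG_pow _ hδε _ h]
    · rw [hG_zero _ (by positivity) hδε _ h, hG_zero _ hε0 le_rfl _ h]
  have hlow : 1 ≤ quotientNorm K (n + 1) f :=
    one_le_quotientNorm_of_eq_sub_pow (z := z) hcard inter_subset_left fun x hx =>
      hG_pow ε hδε x (abs_lt.2 ⟨by linarith [hx.2.1], by linarith [hx.2.2]⟩)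
  have hn_le : quotientNorm K n f ≤ 2 * δ * A := by
    refine quotientNorm_le_of_isSmoothExtension hext' (by positivity)
      ((smoothNorm_rescale_le ψ hψ n (n + 1) A hψA z (2 * δ) (by positivity)
        (by linarith)).trans_eq ?_)
    -- One power of `r = 2δ` is left from `r ^ (n + 1) * r⁻¹ ^ n`.
    rw [pow_succ, mul_right_comm _ (2 * δ), ← mul_pow, mul_inv_cancel₀ (by positivity), one_pow,
      one_mul]
  have hk_le : quotientNorm K k f ≤ ε⁻¹ ^ k * B := by
    refine quotientNorm_le_of_isSmoothExtension hext (by positivity)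
      ((smoothNorm_rescale_le ψ hψ k (n + 1) B hψB z ε hε0 (by linarith)).trans
        (ENNReal.ofReal_le_ofReal ?_))
    have : ε ^ (n + 1) ≤ 1 := pow_le_one₀ hε0.le (by linarith)
    rw [mul_assoc]
    exact mul_le_of_le_one_left (by positivity) this
  have hsmall : c * B * (2 * A) * ε ^ (a + 2) < 1 := by
    have h1 : ε ^ (a + 2) ≤ (1 / 2) ^ a :=
      (pow_le_pow_of_le_one hε0.le (by linarith) (by omega)).trans
        (pow_le_pow_left₀ hε0.le hε.le a)
    rw [← lt_inv_mul_iff₀ (by positivity), mul_one]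
    exact h1.trans_lt ha
  have hupper : quotientNorm K (n + 1) f ^ 2 ≤ c * B * (2 * A) * ε ^ (a + 2) := by
    calc quotientNorm K (n + 1) f ^ 2 ≤ c * quotientNorm K k f * quotientNorm K n f := hdom f
      _ ≤ c * (ε⁻¹ ^ k * B) * (2 * δ * A) := by gcongr
      _ = c * B * (2 * A) * ε ^ (a + 2) := by
        have : ε⁻¹ ^ k * ε ^ k = 1 := by rw [← mul_pow, inv_mul_cancel₀ hε0.ne', one_pow]
        rw [hδ, add_assoc, pow_add ε k]
        linear_combination c * B * (2 * A) * ε ^ (a + 2) * this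
  linarith [one_le_pow₀ (n := 2) hlow]
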